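/- Fix $n\ge 0$. A hermitian linear pencil of size $d\ge 1$ in freely noncommuting variables $x_1,\dots,x_n$ is $L=A_0+A_1x_1+\cdots+A_nx_n$ with hermitian coefficients $A_0,\dots,A_n\in M_d(\mathbb{C})$; it is monic if $A_0=I$. For a tuple $X=(X_1,\dots,X_n)$ of hermitian $k\times k$ complex matrices put $L(X)=A_0\otimes I_k+A_1\otimes X_1+\cdots+A_n\otimes X_n$, and let $$\mathcal{D}_L=\bigcup_{k\ge 1}\{X=(X_1,\dots,X_n)\colon X_j=X_j^*\in M_k(\mathbb{C}),\ L(X)\succeq 0\}$$ be the free spectrahedron of $L$. A hermitian pencil $L$ is minimal if its size is the smallest among the sizes of all hermitian pencils $M$ (monic or not) with $\mathcal{D}_M=\mathcal{D}_L$. Monic pencils $L$ and $M$ are unitarily similar if they have the same size $d$ and $M=ULU^{-1}$ for some unitary $U\in M_d(\mathbb{C})$. Let $L$ and $M$ be minimal monic hermitian linear pencils. Then $\mathcal{D}_L=\mathcal{D}_M$ if and only if $L$ and $M$ are unitarily similar. Consequently, every free spectrahedron $\mathcal{D}_L$ given by a monic hermitian pencil $L$ is represented by a monic hermitian pencil that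 is minimal, and this minimal monic representation is unique up to unitary similarity. -/

import Mathlib

open scoped Matrix Kronecker ComplexOrder

/-- A linear matrix pencil `L = A₀ + A₁ x₁ + ⋯ + Aₙ xₙ` of size `d ≥ 1` in `n` freely noncommuting
variables, given by its coefficients `A₀, A₁, …, Aₙ ∈ M_d(ℂ)`. -/
structure LinearPencil (n : ℕ) where
  /-- the size `d` of the pencil -/
  size : ℕ
  size_pos : 0 < size
  /-- the constant coefficient `A₀` -/
  const : Matrix (Fin size) (Fin size) ℂ
  /-- the coefficients of the variables -/
  coeff : Fin n → Matrix (Fin size) (Fin size) ℂ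

namespace LinearPencil

variable {n : ℕ}

/-- All coefficients are hermitian matrices. -/
def IsHermitian (L : LinearPencil n) : Prop :=
  L.const.IsHermitian ∧ ∀ j, (L.coeff j).IsHermitian

/-- The constant coefficient is the identity matrix. -/
def IsMonic (L : LinearPencil n) : Prop := L.const = 1

/-- The evaluation `L(X) = A₀ ⊗ I + A₁ ⊗ X₁ + ⋯ + Aₙ ⊗ Xₙ` at a tuple of `k × k` matrices. -/
def eval (L : LinearPencil n) {k : ℕ} (X : Fin n → Matrix (Fin k) (Fin k) ℂ) :
    Matrix (Fin L.size × Fin k) (Fin L.size × Fin k) ℂ :=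
  L.const ⊗ₖ (1 : Matrix (Fin k) (Fin k) ℂ) + ∑ j, L.coeff j ⊗ₖ X j

/-- The set `D_L`: all tuples of hermitian `k × k` matrices, over all `k ≥ 1`, at which `L` is
positive semidefinite. It is a free spectrahedron when `L` is hermitian. A point is a pair of the
matrix size `k` and a tuple of matrices of this size. -/
def positivityDomain (L : LinearPencil n) :
    Set (Σ k : ℕ, Fin n → Matrix (Fin k) (Fin k) ℂ) :=
  {X | 0 < X.1 ∧ (∀ j, (X.2 j).IsHermitian) ∧ (L.eval X.2).PosSemidef}

/-- `L` has the least size among all hermitian pencils (monic or not) that represent `D_L`. -/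
def IsMinimal (L : LinearPencil n) : Prop :=
  ∀ M : LinearPencil n, M.IsHermitian → M.positivityDomain = L.positivityDomain → L.size ≤ M.size

/-- `M = U L U⁻¹` for a unitary matrix `U`; in particular `L` and `M` have the same size. -/
def UnitarilySimilar (L M : LinearPencil n) : Prop :=
  ∃ (h : L.size = M.size) (U : Matrix (Fin M.size) (Fin M.size) ℂ),
    U ∈ Matrix.unitaryGroup (Fin M.size) ℂ ∧
    M.const = U * Matrix.reindex (finCongr h) (finCongr h) L.const * U⁻¹ ∧
    ∀ j, M.coeff j = U * Matrix.reindex (finCongr h) (finCongr h) (L.coeff j) * U⁻¹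

end LinearPencil

/-!
Write `krausMap V x = ∑ᵢ Vᵢᴴ x Vᵢ`; such a map is called subunital if `krausMap V 1 ≤ 1`.

*Inclusions are completely positive maps.* For monic hermitian pencils with coefficients `Aⱼ`, `Bⱼ`,
`D_L ⊆ D_M` holds iff a subunital map sends every `Aⱼ` to `Bⱼ`. One direction is a computation
(`positivityDomain_subset_of_krausMap`), the other a Hahn–Banach separation
(`exists_krausMap_or_exists_separating`, `exists_krausMap_of_positivityDomain_subset`).

*Minimality is faithfulness.* If the Kraus operators of a map from `M` to a pencil `N` with
`D_N = D_M` all have their ranges in a proper subspace, then the compression of `M` to that subspace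
represents `D_M` too, so `M` is not minimal (`IsMinimal.eq_zero_of_mul_eq_zero`). Unless all
coefficients vanish, maps between minimal pencils representing the same set are therefore faithful.

*Rigidity.* Let `φ : Aⱼ ↦ Bⱼ` and `ψ : Bⱼ ↦ Aⱼ` be subunital. The map `ψ ∘ φ` fixes `Aⱼ`, and by the
Kadison–Schwarz inequality and faithfulness also `Aⱼ²` (`IsMinimal.krausMap_mul_self`). Hence
`Aⱼ² = ψ (φ (Aⱼ²)) ≥ ψ (Bⱼ²) ≥ Aⱼ²`, so `φ (Aⱼ²) = Bⱼ²` as `ψ` is faithful, and equality in the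
Kadison–Schwarz inequality says that the Kraus operators of `φ` intertwine `A` and `B`
(`coeff_mul_eq_mul_coeff`). Minimality of `M` once more yields an isometric, hence unitary,
intertwiner (`exists_isometry_intertwiner`). This replaces Arveson's boundary theorem and the
decomposition of pencils into irreducible blocks.

*Existence.* Take a hermitian pencil of least size representing `D_L`. As `0` is interior to `D_L`,
its constant coefficient is positive definite (`IsMinimal.const_posDef`), unless it has no variables
at all, and a congruence makes it monic without changing the size.
-/

open scoped MatrixOrder

/-! ### Completely positive maps in Kraus form -/

section Kraus

variable {ι κ p q r : Type*} [Fintype ι] [Fintype κ] [Fintype p]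

/-- The completely positive map `x ↦ ∑ᵢ Vᵢᴴ x Vᵢ` with Kraus operators `Vᵢ`. -/
noncomputable def krausMap (V : ι → Matrix p q ℂ) : Matrix p p ℂ →ₗ[ℂ] Matrix q q ℂ where
  toFun x := ∑ i, (V i)ᴴ * x * V i
  map_add' x y := by simp [Matrix.mul_add, Matrix.add_mul, Finset.sum_add_distrib]
  map_smul' c x := by simp [Finset.smul_sum]

theorem krausMap_apply (V : ι → Matrix p q ℂ) (x : Matrix p p ℂ) :
    krausMap V x = ∑ i, (V i)ᴴ * x * V i := rfl

theorem krausMap_const (V : Matrix p q ℂ) (x : Matrix p p ℂ) :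
    krausMap (fun _ : Unit => V) x = Vᴴ * x * V := by
  simp [krausMap_apply]

theorem krausMap_comp [Fintype q] (V : ι → Matrix p q ℂ) (W : κ → Matrix q r ℂ) (x : Matrix p p ℂ) :
    krausMap (fun ij : ι × κ => V ij.1 * W ij.2) x = krausMap W (krausMap V x) := by
  simp only [krausMap_apply, Fintype.sum_prod_type, Matrix.conjTranspose_mul, Matrix.mul_sum,
    Matrix.sum_mul, Matrix.mul_assoc]
  rw [Finset.sum_comm]

theorem krausMap_nonneg [Fintype q] (V : ι → Matrix p q ℂ) {x : Matrix p p ℂ} (hx : 0 ≤ x) :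
    0 ≤ krausMap V x :=
  Finset.sum_nonneg fun i _ => Matrix.nonneg_iff_posSemidef.2
    ((Matrix.nonneg_iff_posSemidef.1 hx).conjTranspose_mul_mul_same (V i))

theorem krausMap_mono [Fintype q] (V : ι → Matrix p q ℂ) {x y : Matrix p p ℂ} (h : x ≤ y) :
    krausMap V x ≤ krausMap V y := by
  rw [← sub_nonneg, ← map_sub]
  exact krausMap_nonneg V (sub_nonneg.2 h)

theorem mul_eq_zero_of_krausMap_eq_zero [Fintype q] {V : ι → Matrix p q ℂ} {x : Matrix p p ℂ}
    (hx : 0 ≤ x) (h : krausMap V x = 0) (i : ι) : x * V i = 0 := by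
  classical
  have h1 := (Finset.sum_eq_zero_iff_of_nonneg (fun i _ => Matrix.nonneg_iff_posSemidef.2
    ((Matrix.nonneg_iff_posSemidef.1 hx).conjTranspose_mul_mul_same (V i)))).1 h i
    (Finset.mem_univ i)
  obtain ⟨Y, rfl⟩ := CStarAlgebra.nonneg_iff_eq_star_mul_self.1 hx
  rw [Matrix.star_eq_conjTranspose] at h1 ⊢
  have h2 : (Y * V i)ᴴ * (Y * V i) = 0 := by
    rw [← h1]; simp only [Matrix.conjTranspose_mul, Matrix.mul_assoc]
  rw [Matrix.mul_assoc, Matrix.conjTranspose_mul_self_eq_zero.1 h2, Matrix.mul_zero]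

theorem trace_krausMap_one [Fintype q] [DecidableEq p] (V : ι → Matrix p q ℂ) :
    (krausMap V 1).trace = ((∑ i, ∑ b, ∑ a, ‖V i a b‖ ^ 2 : ℝ) : ℂ) := by
  rw [krausMap_apply, Matrix.trace_sum]
  push_cast
  refine Finset.sum_congr rfl fun i _ => ?_
  simp [Matrix.trace, Matrix.mul_apply, Complex.conj_mul']

theorem krausMap_sum_elim (V : ι → Matrix p q ℂ) (W : κ → Matrix p q ℂ) (x : Matrix p p ℂ) :
    krausMap (Sum.elim V W) x = krausMap V x + krausMap W x := by
  simp [krausMap_apply]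

theorem krausMap_smul (c : ℝ) (V : ι → Matrix p q ℂ) (x : Matrix p p ℂ) :
    krausMap (c • V) x = (c ^ 2) • krausMap V x := by
  simp [krausMap_apply, Finset.smul_sum, smul_smul, sq, Matrix.conjTranspose_smul]

theorem krausMap_apply_apply (V : ι → Matrix p q ℂ) (x : Matrix p p ℂ) (a b : q) :
    krausMap V x a b = ∑ l, ∑ k, x k l * ∑ i, star (V i k a) * V i l b := by
  simp only [krausMap_apply, Matrix.sum_apply, Matrix.mul_apply, Matrix.conjTranspose_apply,
    Finset.sum_mul, Finset.mul_sum]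
  rw [Finset.sum_comm]
  refine Finset.sum_congr rfl fun l _ => ?_
  rw [Finset.sum_comm]
  exact Finset.sum_congr rfl fun k _ => Finset.sum_congr rfl fun s _ => by ring

/-- Choi's theorem: `|p| · |q|` Kraus operators suffice. They are the rows of a square root of the
(positive semidefinite) Choi matrix. -/
theorem exists_krausMap_eq [Fintype q] [DecidableEq p] [DecidableEq q] (V : ι → Matrix p q ℂ) :
    ∃ W : p × q → Matrix p q ℂ, krausMap W = krausMap V := by
  have hP : (∑ i, Matrix.vecMulVec (star fun ka : p × q => V i ka.1 ka.2)
      (fun ka : p × q => V i ka.1 ka.2)).PosSemidef :=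
    Matrix.posSemidef_sum _ fun i _ => Matrix.posSemidef_vecMulVec_star_self _
  obtain ⟨Y, hY⟩ := CStarAlgebra.nonneg_iff_eq_star_mul_self.1 hP.nonneg
  refine ⟨fun s => Matrix.of fun k a => Y s (k, a), LinearMap.ext fun x => ?_⟩
  ext a b
  have key : ∀ k l, ∑ s, star (Y s (k, a)) * Y s (l, b) = ∑ i, star (V i k a) * V i l b := by
    intro k l
    have := congrFun (congrFun hY (k, a)) (l, b)
    simpa [Matrix.sum_apply, Matrix.vecMulVec_apply, Matrix.mul_apply] using this.symm
  simp only [krausMap_apply_apply, Matrix.of_apply, key]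

theorem krausMap_mul_self_sub [Fintype q] [DecidableEq p] [DecidableEq q] (V : ι → Matrix p q ℂ)
    {A : Matrix p p ℂ} {B : Matrix q q ℂ} (hA : A.IsHermitian) (hB : B.IsHermitian)
    (h : krausMap V A = B) :
    krausMap V (A * A) - B * B =
      (∑ i, (A * V i - V i * B)ᴴ * (A * V i - V i * B)) + B * (1 - krausMap V 1) * B := by
  have h1 : ∑ i, (A * V i - V i * B)ᴴ * (A * V i - V i * B) =
      krausMap V (A * A) - krausMap V A * B - B * krausMap V A + B * krausMap V 1 * B := by
    simp only [krausMap_apply, Matrix.sum_mul, Matrix.mul_sum, ← Finset.sum_sub_distrib,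
      ← Finset.sum_add_distrib]
    refine Finset.sum_congr rfl fun i _ => ?_
    simp only [Matrix.conjTranspose_sub, Matrix.conjTranspose_mul, hA.eq, hB.eq, Matrix.mul_one,
      Matrix.mul_sub, Matrix.sub_mul, Matrix.mul_assoc]
    abel
  rw [h1, h]
  noncomm_ring

/-- The Kadison–Schwarz inequality for subunital maps. -/
theorem mul_self_le_krausMap [Fintype q] [DecidableEq p] [DecidableEq q] (V : ι → Matrix p q ℂ)
    {A : Matrix p p ℂ} {B : Matrix q q ℂ} (hA : A.IsHermitian) (hB : B.IsHermitian)
    (h : krausMap V A = B) (h1 : krausMap V 1 ≤ 1) : B * B ≤ krausMap V (A * A) := by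
  rw [← sub_nonneg, krausMap_mul_self_sub V hA hB h]
  refine add_nonneg (Finset.sum_nonneg fun i _ => ?_) ?_
  · exact Matrix.nonneg_iff_posSemidef.2 (Matrix.posSemidef_conjTranspose_mul_self _)
  · have := (Matrix.le_iff.1 h1).conjTranspose_mul_mul_same B
    rw [hB.eq] at this
    exact Matrix.nonneg_iff_posSemidef.2 this

/-- Equality in the Kadison–Schwarz inequality forces the Kraus operators to intertwine. -/
theorem mul_eq_mul_of_krausMap_mul_self [Fintype q] [DecidableEq p] [DecidableEq q]
    (V : ι → Matrix p q ℂ)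
    {A : Matrix p p ℂ} {B : Matrix q q ℂ} (hA : A.IsHermitian) (hB : B.IsHermitian)
    (h : krausMap V A = B) (h1 : krausMap V 1 ≤ 1) (h2 : krausMap V (A * A) = B * B) (i : ι) :
    A * V i = V i * B := by
  have hs := krausMap_mul_self_sub V hA hB h
  rw [h2, sub_self] at hs
  have hn : ∀ i ∈ Finset.univ, 0 ≤ (A * V i - V i * B)ᴴ * (A * V i - V i * B) := fun i _ =>
    Matrix.nonneg_iff_posSemidef.2 (Matrix.posSemidef_conjTranspose_mul_self _)
  have hr : 0 ≤ B * (1 - krausMap V 1) * B := by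
    have := (Matrix.le_iff.1 h1).conjTranspose_mul_mul_same B
    rw [hB.eq] at this
    exact Matrix.nonneg_iff_posSemidef.2 this
  have h3 := ((add_eq_zero_iff_of_nonneg (Finset.sum_nonneg hn) hr).1 hs.symm).1
  have h4 := (Finset.sum_eq_zero_iff_of_nonneg hn).1 h3 i (Finset.mem_univ i)
  exact sub_eq_zero.1 (Matrix.conjTranspose_mul_self_eq_zero.1 h4)

theorem continuous_krausMap (x : Matrix p p ℂ) :
    Continuous fun V : ι → Matrix p q ℂ => krausMap V x := by
  simp only [krausMap_apply]
  fun_prop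

theorem isCompact_trace_krausMap_le [Fintype q] [DecidableEq p] (c : ℝ) :
    IsCompact {V : ι → Matrix p q ℂ | (krausMap V 1).trace.re ≤ c} := by
  have hb : IsCompact (Set.univ.pi fun _ : ι => Set.univ.pi fun _ : p => Set.univ.pi fun _ : q =>
      Metric.closedBall (0 : ℂ) (√c)) :=
    isCompact_univ_pi fun _ => isCompact_univ_pi fun _ => isCompact_univ_pi fun _ =>
      isCompact_closedBall _ _
  refine IsCompact.of_isClosed_subset hb ?_ ?_
  · refine isClosed_le ?_ continuous_const
    exact Complex.continuous_re.comp ((continuous_krausMap 1).matrix_trace)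
  · intro V hV i _ a _ b _
    have hV' : ∑ i, ∑ b, ∑ a, ‖V i a b‖ ^ 2 ≤ c := by
      have := hV
      rwa [Set.mem_ofPred_eq, trace_krausMap_one, Complex.ofReal_re] at this
    rw [mem_closedBall_zero_iff]
    refine Real.le_sqrt_of_sq_le (le_trans ?_ hV')
    refine le_trans ?_ (Finset.single_le_sum (f := fun i => ∑ b, ∑ a, ‖V i a b‖ ^ 2)
      (fun i _ => by positivity) (Finset.mem_univ i))
    refine le_trans ?_ (Finset.single_le_sum (f := fun b => ∑ a, ‖V i a b‖ ^ 2)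
      (fun i _ => by positivity) (Finset.mem_univ b))
    exact Finset.single_le_sum (f := fun a => ‖V i a b‖ ^ 2)
      (fun i _ => by positivity) (Finset.mem_univ a)

theorem isClosed_posSemidef : IsClosed {x : Matrix p p ℂ | x.PosSemidef} := by
  simp only [Matrix.posSemidef_iff_dotProduct_mulVec, Set.ofPred_and, Set.ofPred_forall]
  refine IsClosed.inter ?_ (isClosed_iInter fun v => ?_)
  · exact isClosed_eq (by fun_prop) continuous_id
  · exact isClosed_le continuous_const (by fun_prop)

end Kraus

/-- A positive definite matrix is `Yᴴ Y` with `Y` invertible. -/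
theorem Matrix.PosDef.exists_eq_conjTranspose_mul_self {p : Type*} [Fintype p] [DecidableEq p]
    {X : Matrix p p ℂ} (hX : X.PosDef) : ∃ Y : Matrix p p ℂ, X = Yᴴ * Y ∧ Y * Y⁻¹ = 1 ∧
      Y⁻¹ * Y = 1 := by
  obtain ⟨Y, hY⟩ := CStarAlgebra.nonneg_iff_eq_star_mul_self.1 hX.posSemidef.nonneg
  rw [Matrix.star_eq_conjTranspose] at hY
  have hYdet : IsUnit Y.det := by
    have := (Matrix.isUnit_iff_isUnit_det _).1 hX.isUnit
    rw [hY, Matrix.det_mul] at this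
    exact isUnit_of_mul_isUnit_right this
  exact ⟨Y, hY, Matrix.mul_nonsing_inv Y hYdet, Matrix.nonsing_inv_mul Y hYdet⟩

/-! ### Separation: interpolation by completely positive maps -/

section Duality

variable {κ p q : Type*} [Fintype κ] [Fintype p] [Fintype q]

theorem star_dotProduct_sum_kronecker_mulVec (A : κ → Matrix p p ℂ) (X : κ → Matrix q q ℂ)
    (v : Matrix p q ℂ) :
    star (fun ka : p × q => v ka.1 ka.2) ⬝ᵥ ((∑ j, A j ⊗ₖ X j) *ᵥ fun ka : p × q => v ka.1 ka.2) =
      ∑ j, ∑ a, ∑ b, (vᴴ * A j * v) a b * X j a b := by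
  simp only [dotProduct, Matrix.mulVec, Matrix.sum_apply, Matrix.kronecker_apply, Pi.star_apply,
    Fintype.sum_prod_type, Matrix.mul_apply, Matrix.conjTranspose_apply, Finset.sum_mul,
    Finset.mul_sum]
  calc _ = ∑ k, ∑ a, ∑ l, ∑ b, ∑ j, star (v k a) * (A j k l * X j a b * v l b) := rfl
    _ = ∑ k, ∑ a, ∑ l, ∑ j, ∑ b, star (v k a) * (A j k l * X j a b * v l b) :=
        Finset.sum_congr rfl fun k _ => Finset.sum_congr rfl fun a _ =>
          Finset.sum_congr rfl fun l _ => Finset.sum_comm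
    _ = ∑ k, ∑ a, ∑ j, ∑ l, ∑ b, star (v k a) * (A j k l * X j a b * v l b) :=
        Finset.sum_congr rfl fun k _ => Finset.sum_congr rfl fun a _ => Finset.sum_comm
    _ = ∑ k, ∑ j, ∑ a, ∑ l, ∑ b, star (v k a) * (A j k l * X j a b * v l b) :=
        Finset.sum_congr rfl fun k _ => Finset.sum_comm
    _ = ∑ j, ∑ k, ∑ a, ∑ l, ∑ b, star (v k a) * (A j k l * X j a b * v l b) := Finset.sum_comm
    _ = ∑ j, ∑ a, ∑ k, ∑ l, ∑ b, star (v k a) * (A j k l * X j a b * v l b) :=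
        Finset.sum_congr rfl fun j _ => Finset.sum_comm
    _ = ∑ j, ∑ a, ∑ k, ∑ b, ∑ l, star (v k a) * (A j k l * X j a b * v l b) :=
        Finset.sum_congr rfl fun j _ => Finset.sum_congr rfl fun a _ =>
          Finset.sum_congr rfl fun k _ => Finset.sum_comm
    _ = ∑ j, ∑ a, ∑ b, ∑ k, ∑ l, star (v k a) * (A j k l * X j a b * v l b) :=
        Finset.sum_congr rfl fun j _ => Finset.sum_congr rfl fun a _ => Finset.sum_comm
    _ = ∑ j, ∑ a, ∑ b, ∑ l, ∑ k, star (v k a) * (A j k l * X j a b * v l b) :=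
        Finset.sum_congr rfl fun j _ => Finset.sum_congr rfl fun a _ =>
          Finset.sum_congr rfl fun b _ => Finset.sum_comm
    _ = _ := Finset.sum_congr rfl fun j _ => Finset.sum_congr rfl fun a _ =>
        Finset.sum_congr rfl fun b _ => Finset.sum_congr rfl fun l _ =>
          Finset.sum_congr rfl fun k _ => by ring

/-- Pairing a hermitian `Z` with the hermitian part of `G` gives the real part of its pairing
with `G`. -/
theorem sum_mul_hermitianPart {Z : Matrix q q ℂ} (hZ : Z.IsHermitian) (G : Matrix q q ℂ) :
    ∑ a, ∑ b, Z a b * ((2⁻¹ : ℂ) • (G + Gᴴ)) a b =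
      ((∑ a, ∑ b, Z a b * G a b).re : ℂ) := by
  have h1 : ∑ a, ∑ b, Z a b * star (G b a) = star (∑ a, ∑ b, Z a b * G a b) := by
    rw [star_sum, Finset.sum_comm]
    refine Finset.sum_congr rfl fun a _ => ?_
    rw [star_sum]
    refine Finset.sum_congr rfl fun b _ => ?_
    rw [star_mul', hZ.apply]
  have h2 : ∑ a, ∑ b, Z a b * ((2⁻¹ : ℂ) • (G + Gᴴ)) a b =
      2⁻¹ * ((∑ a, ∑ b, Z a b * G a b) + ∑ a, ∑ b, Z a b * star (G b a)) := by
    simp only [Matrix.smul_apply, Matrix.add_apply, Matrix.conjTranspose_apply, smul_eq_mul,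
      Finset.mul_sum, ← Finset.sum_add_distrib]
    exact Finset.sum_congr rfl fun a _ => Finset.sum_congr rfl fun b _ => by ring
  rw [h2, h1, Complex.star_def, Complex.add_conj]
  push_cast
  ring

theorem continuousLinearMap_apply_eq_sum [DecidableEq κ] [DecidableEq q]
    (g : (κ → Matrix q q ℂ) →L[ℂ] ℂ) (Z : κ → Matrix q q ℂ) :
    g Z = ∑ j, ∑ a, ∑ b, Z j a b * g (Pi.single j (Matrix.single a b 1)) := by
  have hZ : Z = ∑ j, ∑ a, ∑ b, Z j a b • Pi.single j (Matrix.single a b (1 : ℂ)) := by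
    ext j a b
    simp only [Finset.sum_apply, Matrix.sum_apply, Pi.smul_apply, Matrix.smul_apply]
    rw [Finset.sum_eq_single j, Finset.sum_eq_single a, Finset.sum_eq_single b]
    · simp
    · intro b' _ hb; simp [hb]
    · simp
    · intro a' _ ha; simp [ha]
    · simp
    · intro j' _ hj; simp [hj.symm]
    · simp
  conv_lhs => rw [hZ]
  simp [map_sum]

/-- Farkas-type alternative: either a completely positive map sends each `A j` to `B j`, or some
hermitian tuple separates `B` from the images of `A` under completely positive maps. -/
theorem exists_krausMap_or_exists_separating [DecidableEq κ] [DecidableEq p] [DecidableEq q]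
    [Nonempty q]
    {A : κ → Matrix p p ℂ} {B : κ → Matrix q q ℂ} (hA : ∀ j, (A j).IsHermitian)
    (hB : ∀ j, (B j).IsHermitian) {j₀ : κ} (hA₀ : A j₀ = 1) (hB₀ : B j₀ = 1) :
    (∃ V : p × q → Matrix p q ℂ, ∀ j, krausMap V (A j) = B j) ∨
    ∃ X : κ → Matrix q q ℂ, (∀ j, (X j).IsHermitian) ∧ (∑ j, A j ⊗ₖ X j).PosDef ∧
      ¬ (∑ j, B j ⊗ₖ X j).PosSemidef := by
  by_contra! hcon
  obtain ⟨hno, hX⟩ := hcon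
  set K : Set (p × q → Matrix p q ℂ) := {V | (krausMap V 1).trace.re = 1} with hK
  set f : (p × q → Matrix p q ℂ) → κ → Matrix q q ℂ := fun V j => krausMap V (A j) with hf
  have hKc : IsCompact K := by
    refine (isCompact_trace_krausMap_le 1).of_isClosed_subset ?_ fun V hV => le_of_eq hV
    exact isClosed_eq (Complex.continuous_re.comp ((continuous_krausMap 1).matrix_trace))
      continuous_const
  have hfc : IsCompact (f '' K) :=
    hKc.image (continuous_pi fun j => continuous_krausMap (A j))
  have hconv : Convex ℝ (f '' K) := by
    rintro _ ⟨V, hV, rfl⟩ _ ⟨W, hW, rfl⟩ s t hs ht hst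
    obtain ⟨T, hT⟩ := exists_krausMap_eq (Sum.elim (√s • V) (√t • W))
    have hT' : ∀ x, krausMap T x = s • krausMap V x + t • krausMap W x := fun x => by
      rw [hT, krausMap_sum_elim, krausMap_smul, krausMap_smul, Real.sq_sqrt hs, Real.sq_sqrt ht]
    refine ⟨T, ?_, funext fun j => hT' _⟩
    have hV' : (krausMap V 1).trace.re = 1 := hV
    have hW' : (krausMap W 1).trace.re = 1 := hW
    change (krausMap T 1).trace.re = 1
    rw [hT', Matrix.trace_add, Matrix.trace_smul, Matrix.trace_smul]
    simp [hV', hW', hst]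
  have hm : (0 : ℝ) < Fintype.card q := by exact_mod_cast Fintype.card_pos
  have hb : (Fintype.card q : ℝ)⁻¹ • B ∉ f '' K := by
    rintro ⟨V, -, hV⟩
    refine hno (√(Fintype.card q : ℝ) • V) |>.elim fun j hj => hj ?_
    have := congrFun hV j
    rw [krausMap_smul, Real.sq_sqrt hm.le, show krausMap V (A j) = _ from this, Pi.smul_apply,
      smul_smul, mul_inv_cancel₀ hm.ne', one_smul]
  have : LocallyConvexSpace ℝ (Matrix q q ℂ) :=
    inferInstanceAs (LocallyConvexSpace ℝ (q → q → ℂ))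
  obtain ⟨g, u, hgb, hgs⟩ :=
    RCLike.geometric_hahn_banach_point_closed (𝕜 := ℂ) hconv hfc.isClosed hb
  simp only [RCLike.re_eq_complex_re] at hgb hgs
  -- Subtracting `u` times the trace of the `j₀`-component puts the separating value at `0`.
  set G : κ → Matrix q q ℂ := fun j => (Matrix.of fun a b =>
    g (Pi.single j (Matrix.single a b 1))) - if j = j₀ then (u : ℂ) • 1 else 0 with hG
  set X : κ → Matrix q q ℂ := fun j => (2⁻¹ : ℂ) • (G j + (G j)ᴴ) with hXdef
  have hXh : ∀ j, (X j).IsHermitian := fun j => by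
    have h2 : star (2⁻¹ : ℂ) = 2⁻¹ := by simp
    rw [Matrix.IsHermitian, hXdef]
    simp only [Matrix.conjTranspose_smul, Matrix.conjTranspose_add,
      Matrix.conjTranspose_conjTranspose, h2, add_comm]
  have hpair : ∀ Z : κ → Matrix q q ℂ, (∀ j, (Z j).IsHermitian) →
      ∑ j, ∑ a, ∑ b, Z j a b * X j a b = (((g Z).re - u * (Z j₀).trace.re : ℝ) : ℂ) := by
    intro Z hZ
    have h1 : ∑ j, ∑ a, ∑ b, Z j a b * G j a b = g Z - u * (Z j₀).trace := by
      rw [continuousLinearMap_apply_eq_sum g Z]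
      simp only [hG, Matrix.sub_apply, Matrix.of_apply, mul_sub, Finset.sum_sub_distrib]
      congr 1
      rw [Finset.sum_eq_single j₀ (fun j _ hj => by simp [hj]) (by simp)]
      simp [Matrix.one_apply, Matrix.trace, Finset.mul_sum, mul_comm]
    calc ∑ j, ∑ a, ∑ b, Z j a b * X j a b
        = ∑ j, ((∑ a, ∑ b, Z j a b * G j a b).re : ℂ) :=
          Finset.sum_congr rfl fun j _ => sum_mul_hermitianPart (hZ j) (G j)
      _ = ((∑ j, ∑ a, ∑ b, Z j a b * G j a b).re : ℂ) := by
          rw [Complex.re_sum]; push_cast; rfl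
      _ = _ := by rw [h1]; simp
  refine absurd (hX X hXh ?_) ?_
  · refine Matrix.PosDef.of_dotProduct_mulVec_pos ?_ fun {x} hx => ?_
    · refine isSelfAdjoint_sum _ fun j _ => ?_
      change (A j ⊗ₖ X j)ᴴ = _
      rw [Matrix.conjTranspose_kronecker, (hA j).eq, (hXh j).eq]
    · set v : Matrix p q ℂ := Matrix.of fun k a => x (k, a) with hv
      have hxv : x = fun ka : p × q => v ka.1 ka.2 := rfl
      rw [hxv, star_dotProduct_sum_kronecker_mulVec, hpair]
      swap
      · intro j
        simp [Matrix.IsHermitian, Matrix.conjTranspose_mul, (hA j).eq, Matrix.mul_assoc]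
      set t : ℝ := (vᴴ * v).trace.re with ht
      have htr : (vᴴ * v).trace = (t : ℂ) := by
        have := trace_krausMap_one (fun _ : Unit => v)
        rw [krausMap_const, Matrix.mul_one] at this
        rw [ht, this, Complex.ofReal_re]
      have htpos : 0 < t := by
        have h0 : (0 : ℂ) ≤ (vᴴ * v).trace :=
          (Matrix.posSemidef_conjTranspose_mul_self v).trace_nonneg
        rw [htr, Complex.zero_le_real] at h0
        refine lt_of_le_of_ne h0 fun h => hx ?_
        have : v = 0 := by
          rw [← Matrix.trace_conjTranspose_mul_self_eq_zero_iff, htr, ← h, Complex.ofReal_zero]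
        rw [hxv, this]; rfl
      obtain ⟨T, hT⟩ := exists_krausMap_eq (fun _ : Unit => (√t)⁻¹ • v)
      have hT' : ∀ y, krausMap T y = t⁻¹ • (vᴴ * y * v) := fun y => by
        rw [hT, ← krausMap_const, show (fun _ : Unit => (√t)⁻¹ • v) = (√t)⁻¹ • fun _ => v from rfl,
          krausMap_smul, inv_pow, Real.sq_sqrt htpos.le]
      have hTK : T ∈ K := by
        change (krausMap T 1).trace.re = 1
        rw [hT', Matrix.mul_one, Matrix.trace_smul, Complex.smul_re, ← ht, smul_eq_mul,
          inv_mul_cancel₀ htpos.ne']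
      have hg := hgs _ ⟨T, hTK, rfl⟩
      have hfT : f T = ((t⁻¹ : ℝ) : ℂ) • fun j => vᴴ * A j * v := by
        funext j
        rw [hf]
        simp only [hT', Pi.smul_apply, Complex.coe_smul]
      rw [hfT, map_smul, smul_eq_mul, Complex.re_ofReal_mul] at hg
      have h3 : u * t < (g fun j => vᴴ * A j * v).re := by
        have := mul_lt_mul_of_pos_right hg htpos
        rwa [mul_comm (t⁻¹), mul_assoc, inv_mul_cancel₀ htpos.ne', mul_one] at this
      rw [hA₀, Matrix.mul_one, ← ht]
      exact_mod_cast sub_pos.2 h3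
  · intro hpsd
    have h1 := hpsd.dotProduct_mulVec_nonneg (fun ka : q × q => (1 : Matrix q q ℂ) ka.1 ka.2)
    rw [star_dotProduct_sum_kronecker_mulVec] at h1
    simp only [Matrix.conjTranspose_one, Matrix.one_mul, Matrix.mul_one] at h1
    rw [hpair B hB, hB₀, Matrix.trace_one, Complex.zero_le_real] at h1
    rw [show (Fintype.card q : ℝ)⁻¹ • B = (((Fintype.card q : ℝ)⁻¹ : ℝ) : ℂ) • B from
      (Complex.coe_smul _ _).symm, map_smul, smul_eq_mul, Complex.re_ofReal_mul] at hgb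
    have h3 := mul_lt_mul_of_pos_left hgb hm
    rw [← mul_assoc, mul_inv_cancel₀ hm.ne', one_mul] at h3
    simp only [Complex.natCast_re] at h1
    linarith
end Duality

namespace LinearPencil

variable {n : ℕ}

/-! ### Completely positive maps between pencils -/

theorem eval_eq_of_krausMap {L M : LinearPencil n} {ι : Type*} [Fintype ι]
    (V : ι → Matrix (Fin L.size) (Fin M.size) ℂ)
    (h : ∀ j, krausMap V (L.coeff j) = M.coeff j)
    {k : ℕ} (X : Fin n → Matrix (Fin k) (Fin k) ℂ) :
    M.eval X = (M.const - krausMap V L.const) ⊗ₖ (1 : Matrix (Fin k) (Fin k) ℂ) +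
      krausMap (fun i => V i ⊗ₖ (1 : Matrix (Fin k) (Fin k) ℂ)) (L.eval X) := by
  have h1 : ∀ (C : Matrix (Fin L.size) (Fin L.size) ℂ) (Y : Matrix (Fin k) (Fin k) ℂ),
      krausMap (fun i => V i ⊗ₖ (1 : Matrix (Fin k) (Fin k) ℂ)) (C ⊗ₖ Y) = krausMap V C ⊗ₖ Y := by
    intro C Y
    have h2 : krausMap V C ⊗ₖ Y = ∑ i, ((V i)ᴴ * C * V i) ⊗ₖ Y := by
      ext a b
      simp [krausMap_apply, Matrix.sum_apply, Finset.sum_mul]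
    rw [h2, krausMap_apply]
    refine Finset.sum_congr rfl fun i _ => ?_
    rw [Matrix.conjTranspose_kronecker, ← Matrix.mul_kronecker_mul, ← Matrix.mul_kronecker_mul]
    simp
  have h3 : (M.const - krausMap V L.const) ⊗ₖ (1 : Matrix (Fin k) (Fin k) ℂ) =
      M.const ⊗ₖ (1 : Matrix (Fin k) (Fin k) ℂ) - krausMap V L.const ⊗ₖ 1 := by
    ext a b
    simp [sub_mul]
  simp only [eval, map_add, map_sum, h1, h, h3]
  abel

/-- A completely positive map sending the coefficients of `L` to those of `M`, the constant one up
to a positive semidefinite slack, shows that `D_L ⊆ D_M`. -/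
theorem positivityDomain_subset_of_krausMap {L M : LinearPencil n} {ι : Type*} [Fintype ι]
    (V : ι → Matrix (Fin L.size) (Fin M.size) ℂ) (h0 : krausMap V L.const ≤ M.const)
    (h : ∀ j, krausMap V (L.coeff j) = M.coeff j) :
    L.positivityDomain ⊆ M.positivityDomain := by
  rintro ⟨k, X⟩ ⟨hk, hX, hL⟩
  refine ⟨hk, hX, ?_⟩
  rw [eval_eq_of_krausMap V h X]
  refine Matrix.PosSemidef.add ?_ ?_
  · exact (Matrix.le_iff.1 h0).kronecker Matrix.PosSemidef.one
  · exact Matrix.nonneg_iff_posSemidef.1 (krausMap_nonneg _ (Matrix.nonneg_iff_posSemidef.2 hL))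

/-- The compression `Wᴴ L W` of a pencil. -/
def compress (L : LinearPencil n) {r : ℕ} (hr : 0 < r) (W : Matrix (Fin L.size) (Fin r) ℂ) :
    LinearPencil n where
  size := r
  size_pos := hr
  const := Wᴴ * L.const * W
  coeff j := Wᴴ * L.coeff j * W

theorem compress_isHermitian {L : LinearPencil n} (hL : L.IsHermitian) {r : ℕ} (hr : 0 < r)
    (W : Matrix (Fin L.size) (Fin r) ℂ) : (L.compress hr W).IsHermitian :=
  ⟨by simp [compress, Matrix.IsHermitian, hL.1.eq, Matrix.mul_assoc],
    fun j => by simp [compress, Matrix.IsHermitian, (hL.2 j).eq, Matrix.mul_assoc]⟩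

theorem positivityDomain_subset_compress (L : LinearPencil n) {r : ℕ} (hr : 0 < r)
    (W : Matrix (Fin L.size) (Fin r) ℂ) :
    L.positivityDomain ⊆ (L.compress hr W).positivityDomain :=
  positivityDomain_subset_of_krausMap (M := L.compress hr W) (fun _ : Unit => W)
    (krausMap_const W L.const).le (fun _ => krausMap_const _ _)

/-- Minimality forbids Kraus operators whose ranges lie in a common proper subspace `ker Q`: the
compression of `M` to that subspace would represent the same set. -/
theorem IsMinimal.eq_zero_of_mul_eq_zero {M N : LinearPencil n} (hM : M.IsHermitian)
    (hmin : M.IsMinimal) (hD : N.positivityDomain = M.positivityDomain) {ι : Type*} [Fintype ι]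
    (V : ι → Matrix (Fin M.size) (Fin N.size) ℂ) (h0 : krausMap V M.const ≤ N.const)
    (h : ∀ j, krausMap V (M.coeff j) = N.coeff j) {Q : Matrix (Fin M.size) (Fin M.size) ℂ}
    (hQ : Q ≠ 0) (hV : ∀ i, Q * V i = 0) (i : ι) : V i = 0 := by
  set K := LinearMap.ker Q.mulVecLin with hK
  have hr : Module.finrank ℂ K < M.size := by
    have := Submodule.finrank_lt (s := K) fun htop => hQ <| by
      have h1 := LinearMap.ker_eq_top.1 htop
      ext a b
      have := congrFun (LinearMap.congr_fun h1 (Pi.single b 1)) a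
      simpa using this
    simpa using this
  set r := Module.finrank ℂ K with hrdef
  let b := Module.finBasis ℂ K
  let W : Matrix (Fin M.size) (Fin r) ℂ := Matrix.of fun a s => (b s : Fin M.size → ℂ) a
  have hcol : ∀ i c, (fun a => V i a c) ∈ K := by
    intro i c
    rw [hK, LinearMap.mem_ker]
    ext a
    simpa [Matrix.mul_apply, Matrix.mulVec, dotProduct] using congrFun (congrFun (hV i) a) c
  let Y : ι → Matrix (Fin r) (Fin N.size) ℂ := fun i => Matrix.of fun s c =>
    b.repr ⟨_, hcol i c⟩ s
  have hWY : ∀ i, V i = W * Y i := by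
    intro i
    ext a c
    have h1 := congrFun (congrArg Subtype.val (b.sum_repr ⟨_, hcol i c⟩)) a
    simp only [Submodule.coe_sum, Submodule.coe_smul, Finset.sum_apply, Pi.smul_apply,
      smul_eq_mul] at h1
    rw [← h1, Matrix.mul_apply]
    exact Finset.sum_congr rfl fun s _ => mul_comm _ _
  rcases Nat.eq_zero_or_pos r with hr0 | hr0
  · rw [hWY]
    ext a c
    have : IsEmpty (Fin r) := by rw [hr0]; infer_instance
    simp [Matrix.mul_apply]
  · exfalso
    have hcomp : ∀ C, krausMap Y (Wᴴ * C * W) = krausMap V C := by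
      intro C
      simp only [krausMap_apply, hWY, Matrix.conjTranspose_mul, Matrix.mul_assoc]
    have h1 : (M.compress hr0 W).positivityDomain ⊆ N.positivityDomain :=
      positivityDomain_subset_of_krausMap (L := M.compress hr0 W) Y
        ((hcomp _).trans_le h0) (fun j => (hcomp _).trans (h j))
    have h2 := hmin (M.compress hr0 W) (compress_isHermitian hM hr0 W)
      (Set.Subset.antisymm (h1.trans hD.le) (M.positivityDomain_subset_compress hr0 W))
    exact absurd h2 (not_le.2 hr)

/-- A completely positive map from a minimal pencil to a pencil representing the same set is
faithful, unless all variables have coefficient zero in the target. -/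
theorem IsMinimal.eq_zero_of_krausMap_eq_zero {M N : LinearPencil n} (hM : M.IsHermitian)
    (hmin : M.IsMinimal) (hD : N.positivityDomain = M.positivityDomain) {ι : Type*} [Fintype ι]
    (V : ι → Matrix (Fin M.size) (Fin N.size) ℂ) (h0 : krausMap V M.const ≤ N.const)
    (h : ∀ j, krausMap V (M.coeff j) = N.coeff j) (hN : ∃ j, N.coeff j ≠ 0)
    {x : Matrix (Fin M.size) (Fin M.size) ℂ} (hx : 0 ≤ x) (hVx : krausMap V x = 0) : x = 0 := by
  by_contra hne
  obtain ⟨j, hj⟩ := hN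
  refine hj ?_
  rw [← h j, krausMap_apply]
  refine Finset.sum_eq_zero fun i _ => ?_
  rw [hmin.eq_zero_of_mul_eq_zero hM hD V h0 h hne
    (fun i => mul_eq_zero_of_krausMap_eq_zero hx hVx i) i, Matrix.mul_zero]

/-- The linear Positivstellensatz: an inclusion `D_L ⊆ D_M` of free spectrahedra of monic pencils
is witnessed by a completely positive map. -/
theorem exists_krausMap_of_positivityDomain_subset {L M : LinearPencil n} (hL : L.IsHermitian)
    (hL1 : L.IsMonic) (hM : M.IsHermitian) (hM1 : M.IsMonic)
    (hD : L.positivityDomain ⊆ M.positivityDomain) :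
    ∃ V : Fin L.size × Fin M.size → Matrix (Fin L.size) (Fin M.size) ℂ,
      krausMap V 1 ≤ 1 ∧ ∀ j, krausMap V (L.coeff j) = M.coeff j := by
  have hne : Nonempty (Fin M.size) := ⟨⟨0, M.size_pos⟩⟩
  -- The extra `1 × 1` block, on which only the constant coefficient lives, absorbs the slack.
  let A : Option (Fin n) → Matrix (Fin L.size ⊕ Unit) (Fin L.size ⊕ Unit) ℂ := fun o =>
    o.elim 1 fun j => Matrix.fromBlocks (L.coeff j) 0 0 0
  let B : Option (Fin n) → Matrix (Fin M.size) (Fin M.size) ℂ := fun o => o.elim 1 M.coeff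
  have hA : ∀ o, (A o).IsHermitian := by
    rintro (_ | j)
    · exact Matrix.isHermitian_one
    · exact Matrix.IsHermitian.fromBlocks (hL.2 j) (by simp) Matrix.isHermitian_zero
  have hB : ∀ o, (B o).IsHermitian := by
    rintro (_ | j)
    · exact Matrix.isHermitian_one
    · exact hM.2 j
  rcases exists_krausMap_or_exists_separating hA hB (j₀ := none) rfl rfl with
    ⟨T, hT⟩ | ⟨X, hX, hpos, hnot⟩
  · obtain ⟨V, hV⟩ := exists_krausMap_eq fun i =>
      (T i).submatrix (Sum.inl : Fin L.size → Fin L.size ⊕ Unit) id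
    have hblk : ∀ (C : Matrix (Fin L.size) (Fin L.size) ℂ) (c : Matrix Unit Unit ℂ),
        krausMap T (Matrix.fromBlocks C 0 0 c) =
          krausMap V C +
            krausMap (fun i => (T i).submatrix (Sum.inr : Unit → Fin L.size ⊕ Unit) id) c := by
      intro C c
      rw [hV]
      simp only [krausMap_apply, ← Finset.sum_add_distrib]
      refine Finset.sum_congr rfl fun i _ => ?_
      ext a b
      simp [Matrix.mul_apply, Fintype.sum_sum_type]
    refine ⟨V, ?_, fun j => ?_⟩
    · have h1 := hT none
      change krausMap T 1 = 1 at h1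
      rw [← Matrix.fromBlocks_one, hblk] at h1
      rw [← h1]
      exact le_add_of_nonneg_right (krausMap_nonneg _ zero_le_one)
    · have h1 := hT (some j)
      change krausMap T (Matrix.fromBlocks (L.coeff j) 0 0 0) = M.coeff j at h1
      rwa [hblk, map_zero, add_zero] at h1
  · exfalso
    refine hnot ?_
    -- The corner of `∑ A o ⊗ X o` at the extra block is `X none`, which is thus positive definite.
    have hX0 : (X none).PosDef := by
      have h1 := hpos.submatrix (e := fun a : Fin M.size => (Sum.inr (), a))
        (fun a b hab => by simpa using hab)
      convert h1 using 1
      ext a b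
      simp [A, Matrix.sum_apply, Fintype.sum_option]
    have hXL : (1 ⊗ₖ X none + ∑ j, L.coeff j ⊗ₖ X (some j)).PosSemidef := by
      have h1 := hpos.posSemidef.submatrix
        (fun ka : Fin L.size × Fin M.size => ((Sum.inl ka.1 : Fin L.size ⊕ Unit), ka.2))
      convert h1 using 1
      ext a b
      simp [A, Matrix.sum_apply, Fintype.sum_option, Matrix.one_apply]
    obtain ⟨Y, hY, hYi, hYi'⟩ := hX0.exists_eq_conjTranspose_mul_self
    have hYc : Yᴴ * (Y⁻¹)ᴴ = 1 := by
      rw [← Matrix.conjTranspose_mul, hYi', Matrix.conjTranspose_one]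
    have hYc' : (Y⁻¹)ᴴ * Yᴴ = 1 := by
      rw [← Matrix.conjTranspose_mul, hYi, Matrix.conjTranspose_one]
    have hconj : ∀ {d : ℕ} (C : Fin n → Matrix (Fin d) (Fin d) ℂ)
        (Z : Matrix (Fin M.size) (Fin M.size) ℂ) (C0 : Matrix (Fin d) (Fin d) ℂ) (Z0)
        (Zs : Fin n → Matrix (Fin M.size) (Fin M.size) ℂ),
        ((1 : Matrix (Fin d) (Fin d) ℂ) ⊗ₖ Z)ᴴ * (C0 ⊗ₖ Z0 + ∑ j, C j ⊗ₖ Zs j) * (1 ⊗ₖ Z) =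
          C0 ⊗ₖ (Zᴴ * Z0 * Z) + ∑ j, C j ⊗ₖ (Zᴴ * Zs j * Z) := by
      intro d C Z C0 Z0 Zs
      simp only [Matrix.conjTranspose_kronecker, Matrix.mul_add, Matrix.add_mul, Matrix.mul_sum,
        Matrix.sum_mul, ← Matrix.mul_kronecker_mul, Matrix.conjTranspose_one, Matrix.one_mul,
        Matrix.mul_one]
    have hmem : (⟨M.size, fun j => (Y⁻¹)ᴴ * X (some j) * Y⁻¹⟩ :
        Σ k : ℕ, Fin n → Matrix (Fin k) (Fin k) ℂ) ∈ L.positivityDomain := by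
      refine ⟨M.size_pos, fun j => ?_, ?_⟩
      · simp [Matrix.IsHermitian, (hX (some j)).eq, Matrix.mul_assoc]
      · have h1 := hXL.conjTranspose_mul_mul_same
          ((1 : Matrix (Fin L.size) (Fin L.size) ℂ) ⊗ₖ Y⁻¹)
        rw [hconj, hY, ← Matrix.mul_assoc, hYc', Matrix.one_mul, hYi] at h1
        rw [eval, hL1]
        exact h1
    have h1 := (hD hmem).2.2.conjTranspose_mul_mul_same
      ((1 : Matrix (Fin M.size) (Fin M.size) ℂ) ⊗ₖ Y)
    rw [eval, hM1, hconj] at h1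
    convert h1 using 1
    rw [Fintype.sum_option]
    congr 1
    · change 1 ⊗ₖ X none = _
      rw [Matrix.mul_one, hY]
    · refine Finset.sum_congr rfl fun j _ => ?_
      change M.coeff j ⊗ₖ X (some j) = _
      congr 1
      calc X (some j) = (Yᴴ * (Y⁻¹)ᴴ) * X (some j) * (Y⁻¹ * Y) := by
            rw [hYc, hYi', Matrix.one_mul, Matrix.mul_one]
        _ = _ := by simp only [Matrix.mul_assoc]

/-! ### Rigidity: the Kraus operators intertwine -/

/-- A subunital completely positive map fixing the coefficients of a minimal monic pencil fixes
their squares. By the Kadison–Schwarz inequality it can only increase `A²`; composing with a map `E`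
for which `tr E(A²)` is maximal shows that `E` kills the increase, and `E` is faithful. -/
theorem IsMinimal.krausMap_mul_self {L : LinearPencil n} (hL : L.IsHermitian) (hL1 : L.IsMonic)
    (hmin : L.IsMinimal) (hne : ∃ j, L.coeff j ≠ 0) {ι : Type*} [Fintype ι]
    (U : ι → Matrix (Fin L.size) (Fin L.size) ℂ) (hU1 : krausMap U 1 ≤ 1)
    (hU : ∀ j, krausMap U (L.coeff j) = L.coeff j) (j : Fin n) :
    krausMap U (L.coeff j * L.coeff j) = L.coeff j * L.coeff j := by
  set A := L.coeff j with hA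
  set T : Set (Fin L.size × Fin L.size → Matrix (Fin L.size) (Fin L.size) ℂ) :=
    {V | krausMap V 1 ≤ 1 ∧ ∀ j, krausMap V (L.coeff j) = L.coeff j} with hT
  have hTc : IsCompact T := by
    refine (isCompact_trace_krausMap_le (L.size : ℝ)).of_isClosed_subset ?_ ?_
    · have h1 : T = (fun V => 1 - krausMap V 1) ⁻¹' {x | x.PosSemidef} ∩
          ⋂ j, {V | krausMap V (L.coeff j) = L.coeff j} := by
        ext V
        simp [hT, Matrix.le_iff]
      rw [h1]
      exact (isClosed_posSemidef.preimage (continuous_const.sub (continuous_krausMap 1))).inter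
        (isClosed_iInter fun j => isClosed_eq (continuous_krausMap _) continuous_const)
    · intro V hV
      have h1 := (Matrix.le_iff.1 hV.1).trace_nonneg
      rw [Matrix.trace_sub, Matrix.trace_one, Fintype.card_fin, sub_nonneg] at h1
      simpa using (Complex.le_def.1 h1).1
  obtain ⟨U', hU'⟩ := exists_krausMap_eq U
  obtain ⟨E, hE, hmax⟩ := hTc.exists_isMaxOn ⟨U', by rw [hU']; exact hU1, by rw [hU']; exact hU⟩
    (f := fun V => (krausMap V (A * A)).trace.re)
    (Complex.continuous_re.comp ((continuous_krausMap (A * A)).matrix_trace)).continuousOn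
  obtain ⟨F, hF⟩ := exists_krausMap_eq fun ij : ι × (Fin L.size × Fin L.size) => U ij.1 * E ij.2
  have hFE : ∀ x, krausMap F x = krausMap E (krausMap U x) := fun x => by
    rw [hF, krausMap_comp]
  have hFT : F ∈ T := by
    refine ⟨?_, fun j => ?_⟩
    · rw [hFE]
      exact (krausMap_mono E hU1).trans hE.1
    · rw [hFE, hU, hE.2]
  have hle : 0 ≤ krausMap U (A * A) - A * A :=
    sub_nonneg.2 (mul_self_le_krausMap U (hL.2 j) (hL.2 j) (hU j) hU1)
  have hEle : 0 ≤ krausMap E (krausMap U (A * A) - A * A) := krausMap_nonneg E hle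
  have htr : (krausMap E (krausMap U (A * A) - A * A)).trace = 0 := by
    have h1 := (Matrix.nonneg_iff_posSemidef.1 hEle).trace_nonneg
    refine le_antisymm ?_ h1
    have h2 : (krausMap F (A * A)).trace.re ≤ (krausMap E (A * A)).trace.re := hmax hFT
    rw [Complex.le_def] at h1 ⊢
    refine ⟨?_, h1.2.symm⟩
    rw [map_sub, Matrix.trace_sub, Complex.sub_re, ← hFE]
    simpa using h2
  have hE0 := (Matrix.nonneg_iff_posSemidef.1 hEle).trace_eq_zero_iff.1 htr
  have hE1 : krausMap E L.const ≤ L.const := by rw [hL1]; exact hE.1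
  exact sub_eq_zero.1
    (hmin.eq_zero_of_krausMap_eq_zero hL rfl E hE1 hE.2 hne hle hE0)

/-- Between minimal monic pencils representing the same set, the Kraus operators of a subunital
completely positive map carrying one to the other intertwine the coefficients. -/
theorem coeff_mul_eq_mul_coeff {L M : LinearPencil n} (hL : L.IsHermitian) (hL1 : L.IsMonic)
    (hLmin : L.IsMinimal) (hM : M.IsHermitian) (hM1 : M.IsMonic) (hMmin : M.IsMinimal)
    (hD : L.positivityDomain = M.positivityDomain) (hne : ∃ j, L.coeff j ≠ 0)
    {ι : Type*} [Fintype ι] (V : ι → Matrix (Fin L.size) (Fin M.size) ℂ)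
    (hV1 : krausMap V 1 ≤ 1) (hV : ∀ j, krausMap V (L.coeff j) = M.coeff j) (i : ι) (j : Fin n) :
    L.coeff j * V i = V i * M.coeff j := by
  obtain ⟨W, hW1, hW⟩ := exists_krausMap_of_positivityDomain_subset hM hM1 hL hL1 hD.ge
  refine mul_eq_mul_of_krausMap_mul_self V (hL.2 j) (hM.2 j) (hV j) hV1 ?_ i
  have h1 := hLmin.krausMap_mul_self hL hL1 hne (fun ij : ι × _ => V ij.1 * W ij.2)
    (by rw [krausMap_comp]; exact (krausMap_mono W hV1).trans hW1)
    (fun j => by rw [krausMap_comp, hV, hW]) j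
  rw [krausMap_comp] at h1
  have h2 : M.coeff j * M.coeff j ≤ krausMap V (L.coeff j * L.coeff j) :=
    mul_self_le_krausMap V (hL.2 j) (hM.2 j) (hV j) hV1
  have h3 : L.coeff j * L.coeff j ≤ krausMap W (M.coeff j * M.coeff j) :=
    mul_self_le_krausMap W (hM.2 j) (hL.2 j) (hW j) hW1
  have h4 : krausMap W (krausMap V (L.coeff j * L.coeff j) - M.coeff j * M.coeff j) = 0 := by
    refine le_antisymm ?_ (krausMap_nonneg W (sub_nonneg.2 h2))
    rw [map_sub, h1]
    exact sub_nonpos.2 h3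
  exact sub_eq_zero.1 (hMmin.eq_zero_of_krausMap_eq_zero hM hD W (by rw [hM1, hL1]; exact hW1)
    hW hne (sub_nonneg.2 h2) h4)

/-! ### From intertwiners to a unitary -/

/-- The partial isometry in the polar decomposition of an intertwiner of hermitian tuples is again
an intertwiner. -/
theorem exists_partialIsometry_intertwiner {p q : Type*} [Fintype p] [Fintype q] [DecidableEq p]
    [DecidableEq q] {κ : Type*} {A : κ → Matrix p p ℂ} {B : κ → Matrix q q ℂ}
    (hA : ∀ j, (A j).IsHermitian) (hB : ∀ j, (B j).IsHermitian) (V : Matrix p q ℂ)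
    (hV : ∀ j, A j * V = V * B j) :
    ∃ W : Matrix p q ℂ, (∀ j, A j * W = W * B j) ∧ W * Wᴴ * W = W ∧
      ∀ x, W *ᵥ x = 0 → V *ᵥ x = 0 := by
  set H := Vᴴ * V with hH
  have hpsd : H.PosSemidef := Matrix.posSemidef_conjTranspose_mul_self V
  have hsa : IsSelfAdjoint H := hpsd.1
  have hcont : ∀ f : ℝ → ℝ, ContinuousOn f (spectrum ℝ H) := fun f =>
    (Matrix.finite_real_spectrum).continuousOn f
  set s : Matrix q q ℂ := cfc (fun x : ℝ => (√x)⁻¹) H with hs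
  have hss : sᴴ = s := (cfc_predicate (fun x : ℝ => (√x)⁻¹) H : IsSelfAdjoint _)
  have hHs : H * s = s * H := by
    have := (cfc_commute_cfc (fun x : ℝ => x) (fun x : ℝ => (√x)⁻¹) H)
    rw [cfc_id' ℝ H] at this
    exact this
  have hBH : ∀ j, Commute H (B j) := fun j => by
    have h1 : Vᴴ * A j = B j * Vᴴ := by
      have := congrArg Matrix.conjTranspose (hV j)
      simpa [Matrix.conjTranspose_mul, (hA j).eq, (hB j).eq] using this
    change Vᴴ * V * B j = B j * (Vᴴ * V)
    rw [Matrix.mul_assoc, ← hV, ← Matrix.mul_assoc, h1, Matrix.mul_assoc]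
  have hBs : ∀ j, s * B j = B j * s := fun j => (hBH j).cfc_real (fun x : ℝ => (√x)⁻¹)
  have hHE : H * (s * H * s) = H := by
    have h1 : cfc (fun x : ℝ => x * ((√x)⁻¹ * x * (√x)⁻¹)) H = cfc (fun x : ℝ => x) H := by
      refine cfc_congr fun x hx => ?_
      have hx0 : 0 ≤ x := spectrum_nonneg_of_nonneg hpsd.nonneg hx
      rcases hx0.eq_or_lt with rfl | hx0
      · simp
      · have h2 : √x ≠ 0 := (Real.sqrt_pos.2 hx0).ne'
        have h3 := Real.mul_self_sqrt hx0.le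
        field_simp
        nlinarith
    rw [cfc_mul _ _ H (hcont _) (hcont _), cfc_mul _ _ H (hcont _) (hcont _),
      cfc_mul _ _ H (hcont _) (hcont _), cfc_id' ℝ H] at h1
    exact h1
  have hVE : V * (s * H * s) = V := by
    have hE : (s * H * s)ᴴ = s * H * s := by
      simp only [Matrix.conjTranspose_mul, hss, hpsd.1.eq, Matrix.mul_assoc]
    have h1 : (V * (s * H * s) - V)ᴴ * (V * (s * H * s) - V) = 0 := by
      have : (V * (s * H * s) - V)ᴴ * (V * (s * H * s) - V) =
          (s * H * s) * (H * (s * H * s)) - (s * H * s) * H - H * (s * H * s) + H := by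
        rw [Matrix.conjTranspose_sub, Matrix.conjTranspose_mul, hE]
        simp only [Matrix.sub_mul, Matrix.mul_sub, hH, Matrix.mul_assoc]
        abel
      rw [this, hHE]
      abel
    exact sub_eq_zero.1 (Matrix.conjTranspose_mul_self_eq_zero.1 h1)
  refine ⟨V * s, fun j => ?_, ?_, fun x hx => ?_⟩
  · rw [← Matrix.mul_assoc, hV, Matrix.mul_assoc, ← hBs, ← Matrix.mul_assoc]
  · have h1 : V * s * (V * s)ᴴ * (V * s) = V * (s * (s * H * s)) := by
      simp only [Matrix.conjTranspose_mul, hss, hH, Matrix.mul_assoc]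
    have h2 : s * (s * H * s) = s * H * s * s := by
      rw [Matrix.mul_assoc s H s, hHs]
      simp only [Matrix.mul_assoc]
      rw [hHs]
    rw [h1, h2, ← Matrix.mul_assoc, hVE]
  · rw [← hVE, show V * (s * H * s) = V * s * Vᴴ * (V * s) by
      simp only [hH, Matrix.mul_assoc], ← Matrix.mulVec_mulVec, hx, Matrix.mulVec_zero]

/-- Among all intertwiners there is a partial isometry `V` with the smallest kernel. Any operator
`Vᵢ` of a completely positive map from `L` to `M` has to send `ker V` into `ran V`, since otherwise
a corner of `Vᵢ` could be added to `V`. Hence `M` is the image of its own compression to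
`(ker V)ᗮ` under a completely positive map, and minimality gives `ker V = 0`. -/
theorem exists_isometry_intertwiner {L M : LinearPencil n} (hL : L.IsHermitian) (hL1 : L.IsMonic)
    (hLmin : L.IsMinimal) (hM : M.IsHermitian) (hM1 : M.IsMonic) (hMmin : M.IsMinimal)
    (hD : L.positivityDomain = M.positivityDomain) (hne : ∃ j, L.coeff j ≠ 0) :
    ∃ V : Matrix (Fin L.size) (Fin M.size) ℂ,
      Vᴴ * V = 1 ∧ ∀ j, L.coeff j * V = V * M.coeff j := by
  obtain ⟨K, hK1, hK⟩ := exists_krausMap_of_positivityDomain_subset hL hL1 hM hM1 hD.le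
  have hKint := coeff_mul_eq_mul_coeff hL hL1 hLmin hM hM1 hMmin hD hne K hK1 hK
  have hneM : ∃ j, M.coeff j ≠ 0 := by
    by_contra! h0
    obtain ⟨W, -, hW⟩ := exists_krausMap_of_positivityDomain_subset hM hM1 hL hL1 hD.ge
    obtain ⟨j, hj⟩ := hne
    exact hj (by rw [← hW j, h0 j, map_zero])
  let ker : Matrix (Fin L.size) (Fin M.size) ℂ → Submodule ℂ (Fin M.size → ℂ) := fun V =>
    LinearMap.ker V.mulVecLin
  have hex : ∃ k : ℕ, ∃ V : Matrix (Fin L.size) (Fin M.size) ℂ,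
      (∀ j, L.coeff j * V = V * M.coeff j) ∧ Module.finrank ℂ (ker V) = k :=
    ⟨_, 0, by simp, rfl⟩
  classical
  obtain ⟨V₀, hV₀, hk⟩ := Nat.find_spec hex
  have hmin : ∀ W : Matrix (Fin L.size) (Fin M.size) ℂ, (∀ j, L.coeff j * W = W * M.coeff j) →
      Module.finrank ℂ (ker V₀) ≤ Module.finrank ℂ (ker W) := fun W hW => by
    rw [hk]
    exact Nat.find_min' hex ⟨W, hW, rfl⟩
  obtain ⟨V, hV, hVV, hVker⟩ := exists_partialIsometry_intertwiner hL.2 hM.2 V₀ hV₀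
  have hVmin : ∀ W : Matrix (Fin L.size) (Fin M.size) ℂ, (∀ j, L.coeff j * W = W * M.coeff j) →
      ker W ≤ ker V → ker W = ker V := fun W hW hle =>
    Submodule.eq_of_le_of_finrank_le hle
      ((Submodule.finrank_mono (show ker V ≤ ker V₀ from hVker)).trans (hmin W hW))
  have hVc : ∀ j, Vᴴ * L.coeff j = M.coeff j * Vᴴ := fun j => by
    have := congrArg Matrix.conjTranspose (hV j)
    simpa [Matrix.conjTranspose_mul, (hL.2 j).eq, (hM.2 j).eq] using this
  have hVVc : Vᴴ * V * Vᴴ = Vᴴ := by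
    have := congrArg Matrix.conjTranspose hVV
    simpa [Matrix.conjTranspose_mul, Matrix.mul_assoc] using this
  -- `P` is the projection onto `ker V`, and `1 - V * Vᴴ` the one onto the complement of `ran V`.
  set E : Matrix (Fin M.size) (Fin M.size) ℂ := Vᴴ * V with hE
  set P : Matrix (Fin M.size) (Fin M.size) ℂ := 1 - E with hP
  have hEh : Eᴴ = E := by simp [hE, Matrix.conjTranspose_mul]
  have hEE : E * E = E := by rw [hE, ← Matrix.mul_assoc, hVVc]
  have hVE : V * E = V := by rw [hE, ← Matrix.mul_assoc, hVV]
  have hEV : E * Vᴴ = Vᴴ := hVVc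
  have hPh : Pᴴ = P := by simp [hP, hEh]
  have hPE : P * E = 0 := by rw [hP, Matrix.sub_mul, hEE, Matrix.one_mul, sub_self]
  have hPP : P * P = P := by
    nth_rewrite 2 [hP]
    rw [Matrix.mul_sub, hPE, Matrix.mul_one, sub_zero]
  have hVP : V * P = 0 := by rw [hP, Matrix.mul_sub, hVE, Matrix.mul_one, sub_self]
  have hPV : P * Vᴴ = 0 := by rw [hP, Matrix.sub_mul, hEV, Matrix.one_mul, sub_self]
  have hEB : ∀ j, M.coeff j * E = E * M.coeff j := fun j => by
    rw [hE, ← Matrix.mul_assoc, ← hVc, Matrix.mul_assoc, hV, ← Matrix.mul_assoc]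
  have hPB : ∀ j, M.coeff j * P = P * M.coeff j := fun j => by
    rw [hP, Matrix.mul_sub, Matrix.sub_mul, hEB, Matrix.one_mul, Matrix.mul_one]
  have hcorner : ∀ i, K i * P = V * Vᴴ * K i * P := by
    intro i
    set T := (1 - V * Vᴴ) * K i * P with hT
    have hVT : Vᴴ * T = 0 := by
      have h1 : Vᴴ * (1 - V * Vᴴ) = 0 := by
        rw [Matrix.mul_sub, ← Matrix.mul_assoc, ← hE, hEV, Matrix.mul_one, sub_self]
      rw [hT, ← Matrix.mul_assoc, ← Matrix.mul_assoc, h1, Matrix.zero_mul, Matrix.zero_mul]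
    have hTint : ∀ j, L.coeff j * T = T * M.coeff j := fun j => by
      have h1 : L.coeff j * (1 - V * Vᴴ) = (1 - V * Vᴴ) * L.coeff j := by
        rw [Matrix.mul_sub, Matrix.sub_mul, ← Matrix.mul_assoc, hV, Matrix.mul_assoc, ← hVc,
          Matrix.mul_assoc, Matrix.one_mul, Matrix.mul_one]
      rw [hT, ← Matrix.mul_assoc, ← Matrix.mul_assoc, h1, Matrix.mul_assoc _ (L.coeff j), hKint,
        Matrix.mul_assoc _ P, ← hPB]
      simp only [Matrix.mul_assoc]
    have hsub : ∀ x, (V + T) *ᵥ x = 0 → V *ᵥ x = 0 := fun x hx => by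
      have h1 : (V * Vᴴ) *ᵥ ((V + T) *ᵥ x) = 0 := by rw [hx, Matrix.mulVec_zero]
      rwa [Matrix.mulVec_mulVec, Matrix.mul_add, hVV, Matrix.mul_assoc, hVT, Matrix.mul_zero,
        add_zero] at h1
    have hker := hVmin (V + T) (fun j => by
      rw [Matrix.mul_add, Matrix.add_mul, hV, hTint]) hsub
    have hT0 : T = 0 := by
      refine Matrix.ext_of_mulVec_single fun b => ?_
      rw [Matrix.zero_mulVec]
      have h1 : P *ᵥ Pi.single b 1 ∈ ker V := by
        change V *ᵥ (P *ᵥ _) = 0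
        rw [Matrix.mulVec_mulVec, hVP, Matrix.zero_mulVec]
      rw [← hker] at h1
      have h2 : (V + T) *ᵥ (P *ᵥ Pi.single b 1) = 0 := h1
      rwa [Matrix.mulVec_mulVec, Matrix.add_mul, hVP, zero_add, hT, Matrix.mul_assoc, hPP] at h2
    rw [hT, Matrix.sub_mul, Matrix.sub_mul, Matrix.one_mul] at hT0
    exact sub_eq_zero.1 hT0
  let R : Option (Fin L.size × Fin M.size) → Matrix (Fin M.size) (Fin M.size) ℂ := fun o =>
    o.elim E fun i => Vᴴ * K i * P
  have hRx : ∀ x, krausMap R x = E * x * E + P * krausMap K (V * x * Vᴴ) * P := by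
    intro x
    rw [krausMap_apply, Fintype.sum_option]
    simp only [R, Option.elim, krausMap_apply, Matrix.mul_sum, Matrix.sum_mul,
      Matrix.conjTranspose_mul, hEh, hPh, Matrix.conjTranspose_conjTranspose, Matrix.mul_assoc]
  have hKP : ∀ C, P * krausMap K (V * Vᴴ * C) * P = P * krausMap K C * P := by
    intro C
    simp only [krausMap_apply, Matrix.mul_sum, Matrix.sum_mul]
    refine Finset.sum_congr rfl fun i _ => ?_
    have h1 : P * (K i)ᴴ * (V * Vᴴ) = P * (K i)ᴴ := by
      have := congrArg Matrix.conjTranspose (hcorner i)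
      simp only [Matrix.conjTranspose_mul, hPh, Matrix.conjTranspose_conjTranspose] at this
      rw [Matrix.mul_assoc, ← this]
    calc P * ((K i)ᴴ * (V * Vᴴ * C) * K i) * P = P * (K i)ᴴ * (V * Vᴴ) * (C * K i * P) := by
          simp only [Matrix.mul_assoc]
      _ = _ := by rw [h1]; simp only [Matrix.mul_assoc]
  have hR1 : krausMap R M.const ≤ M.const := by
    rw [hM1, hRx, Matrix.mul_one, Matrix.mul_one, hEE]
    have h1 := hKP 1
    rw [Matrix.mul_one] at h1
    rw [h1]
    have h2 := (Matrix.le_iff.1 hK1).conjTranspose_mul_mul_same P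
    have h3 : P * krausMap K 1 * P ≤ P := by
      rw [Matrix.le_iff]
      convert h2 using 1
      rw [hPh, Matrix.mul_sub P 1, Matrix.mul_one, Matrix.sub_mul P (P * krausMap K 1) P, hPP]
    calc E + P * krausMap K 1 * P ≤ E + P := add_le_add_right h3 E
      _ = 1 := by rw [hP]; abel
  have hRc : ∀ j, krausMap R (M.coeff j) = M.coeff j := by
    intro j
    have h0 : V * M.coeff j * Vᴴ = V * Vᴴ * L.coeff j := by
      rw [Matrix.mul_assoc, ← hVc, ← Matrix.mul_assoc]
    rw [hRx, h0, hKP, hK, ← hEB, Matrix.mul_assoc, hEE, ← hPB, Matrix.mul_assoc, hPP,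
      ← Matrix.mul_add, hP, add_sub_cancel, Matrix.mul_one]
  refine ⟨V, ?_, hV⟩
  by_contra hV1
  have hP0 : P ≠ 0 := fun h => hV1 (sub_eq_zero.1 h).symm
  have hR0 := hMmin.eq_zero_of_mul_eq_zero hM rfl R hR1 hRc hP0 (by
    rintro (_ | i)
    · exact hPE
    · change P * (Vᴴ * K i * P) = 0
      rw [← Matrix.mul_assoc, ← Matrix.mul_assoc, hPV, Matrix.zero_mul, Matrix.zero_mul])
  obtain ⟨j, hj⟩ := hneM
  refine hj ?_
  rw [← hRc j, krausMap_apply]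
  exact Finset.sum_eq_zero fun i _ => by rw [hR0 i, Matrix.mul_zero]

/-- The constant pencil `1` of size one. -/
def constOne (n : ℕ) : LinearPencil n where
  size := 1
  size_pos := one_pos
  const := 1
  coeff _ := 0

theorem positivityDomain_eq_constOne {L : LinearPencil n} (h0 : L.const.PosSemidef)
    (h : ∀ j, L.coeff j = 0) : L.positivityDomain = (constOne n).positivityDomain := by
  have key : ∀ (L : LinearPencil n), L.const.PosSemidef → (∀ j, L.coeff j = 0) →
      L.positivityDomain = {X | 0 < X.1 ∧ ∀ j, (X.2 j).IsHermitian} := by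
    intro L h0 h
    ext X
    refine ⟨fun hX => ⟨hX.1, hX.2.1⟩, fun hX => ⟨hX.1, hX.2, ?_⟩⟩
    simp only [eval, h, Matrix.zero_kronecker, Finset.sum_const_zero, add_zero]
    exact h0.kronecker Matrix.PosSemidef.one
  rw [key L h0 h, key (constOne n) Matrix.PosSemidef.one fun _ => rfl]

theorem constOne_isHermitian : (constOne n).IsHermitian :=
  ⟨Matrix.isHermitian_one, fun _ => Matrix.isHermitian_zero⟩

theorem size_eq_of_isMinimal {L M : LinearPencil n} (hL : L.IsHermitian) (hLmin : L.IsMinimal)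
    (hM : M.IsHermitian) (hMmin : M.IsMinimal)
    (hD : L.positivityDomain = M.positivityDomain) : L.size = M.size :=
  le_antisymm (hLmin M hM hD.symm) (hMmin L hL hD)

theorem unitarilySimilar_of_isometry {L M : LinearPencil n} (hL1 : L.IsMonic) (hM1 : M.IsMonic)
    (h : L.size = M.size) (V : Matrix (Fin L.size) (Fin M.size) ℂ) (hV1 : Vᴴ * V = 1)
    (hV : ∀ j, L.coeff j * V = V * M.coeff j) : L.UnitarilySimilar M := by
  obtain ⟨d, hd, A₀, A⟩ := L
  obtain ⟨d', hd', B₀, B⟩ := M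
  obtain rfl : d = d' := h
  have hV2 : V * Vᴴ = 1 := mul_eq_one_comm.1 hV1
  have hinv : (Vᴴ)⁻¹ = V := Matrix.inv_eq_left_inv hV2
  have hr : ∀ C : Matrix (Fin d) (Fin d) ℂ,
      Matrix.reindex (finCongr (rfl : d = d)) (finCongr rfl) C = C := fun C => by ext; simp
  refine ⟨rfl, Vᴴ, ?_, ?_, fun j => ?_⟩
  · rw [Matrix.mem_unitaryGroup_iff, Matrix.star_eq_conjTranspose,
      Matrix.conjTranspose_conjTranspose]
    exact hV1
  · obtain rfl : A₀ = 1 := hL1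
    obtain rfl : B₀ = 1 := hM1
    change (1 : Matrix (Fin d) (Fin d) ℂ) = Vᴴ * Matrix.reindex (finCongr rfl) (finCongr rfl) 1 *
      (Vᴴ)⁻¹
    rw [hr, hinv, Matrix.mul_one]
    exact hV1.symm
  · change B j = Vᴴ * Matrix.reindex (finCongr rfl) (finCongr rfl) (A j) * (Vᴴ)⁻¹
    rw [hr, hinv, Matrix.mul_assoc]
    have hVj : A j * V = V * B j := hV j
    have hV1' : Vᴴ * V = (1 : Matrix (Fin d) (Fin d) ℂ) := hV1
    rw [hVj, ← Matrix.mul_assoc, hV1', Matrix.one_mul]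

theorem UnitarilySimilar.positivityDomain_eq {L M : LinearPencil n} (h : L.UnitarilySimilar M) :
    L.positivityDomain = M.positivityDomain := by
  obtain ⟨d, hd, A₀, A⟩ := L
  obtain ⟨d', hd', B₀, B⟩ := M
  obtain ⟨hs, U, hU, h0, hj⟩ := h
  obtain rfl : d = d' := hs
  have hr : ∀ C : Matrix (Fin d) (Fin d) ℂ,
      Matrix.reindex (finCongr (rfl : d = d)) (finCongr rfl) C = C := fun C => by ext; simp
  have hU1 : U * Uᴴ = (1 : Matrix (Fin d) (Fin d) ℂ) := Matrix.mem_unitaryGroup_iff.1 hU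
  have hU2 : Uᴴ * U = (1 : Matrix (Fin d) (Fin d) ℂ) := Matrix.mem_unitaryGroup_iff'.1 hU
  have hinv : U⁻¹ = Uᴴ := Matrix.inv_eq_left_inv hU2
  have h0' : B₀ = U * A₀ * Uᴴ := by rw [← hinv]; exact h0.trans (by rw [hr])
  have hj' : ∀ j, B j = U * A j * Uᴴ := fun j => by rw [← hinv]; exact (hj j).trans (by rw [hr])
  have hto : ∀ C : Matrix (Fin d) (Fin d) ℂ, krausMap (fun _ : Unit => Uᴴ) C = U * C * Uᴴ :=
    fun C => by rw [krausMap_const, Matrix.conjTranspose_conjTranspose]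
  have hback : ∀ C : Matrix (Fin d) (Fin d) ℂ,
      krausMap (fun _ : Unit => U) (U * C * Uᴴ) = C := fun C => by
    rw [krausMap_const]
    calc Uᴴ * (U * C * Uᴴ) * U = (Uᴴ * U) * C * (Uᴴ * U) := by simp only [Matrix.mul_assoc]
      _ = C := by rw [hU2, Matrix.one_mul, Matrix.mul_one]
  refine Set.Subset.antisymm ?_ ?_
  · exact positivityDomain_subset_of_krausMap (L := ⟨d, hd, A₀, A⟩) (M := ⟨d, hd', B₀, B⟩)
      (fun _ : Unit => Uᴴ) ((hto A₀).trans h0'.symm).le fun j => (hto _).trans (hj' j).symm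
  · exact positivityDomain_subset_of_krausMap (L := ⟨d, hd', B₀, B⟩) (M := ⟨d, hd, A₀, A⟩)
      (fun _ : Unit => U) ((congrArg _ h0').trans (hback A₀)).le
      fun j => (congrArg _ (hj' j)).trans (hback _)

theorem unitarilySimilar_of_positivityDomain_eq {L M : LinearPencil n} (hL : L.IsHermitian)
    (hL1 : L.IsMonic) (hLmin : L.IsMinimal) (hM : M.IsHermitian) (hM1 : M.IsMonic)
    (hMmin : M.IsMinimal) (hD : L.positivityDomain = M.positivityDomain) :
    L.UnitarilySimilar M := by
  have hs := size_eq_of_isMinimal hL hLmin hM hMmin hD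
  by_cases hne : ∃ j, L.coeff j ≠ 0
  · obtain ⟨V, hV1, hV⟩ :=
      exists_isometry_intertwiner hL hL1 hLmin hM hM1 hMmin hD hne
    exact unitarilySimilar_of_isometry hL1 hM1 hs V hV1 hV
  · push Not at hne
    obtain ⟨K, -, hK⟩ := exists_krausMap_of_positivityDomain_subset hL hL1 hM hM1 hD.le
    have hM0 : ∀ j, M.coeff j = 0 := fun j => by rw [← hK j, hne j, map_zero]
    refine unitarilySimilar_of_isometry hL1 hM1 hs ((1 : Matrix _ _ ℂ).submatrix (finCongr hs) id)
      ?_ fun j => by rw [hne j, hM0 j, Matrix.zero_mul, Matrix.mul_zero]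
    rw [Matrix.conjTranspose_submatrix, Matrix.submatrix_mul_equiv, Matrix.conjTranspose_one,
      Matrix.one_mul, Matrix.submatrix_id_id]

/-! ### Existence of a minimal monic representation -/

theorem exists_pos_posSemidef_one_add_smul {p : Type*} [Fintype p] [DecidableEq p]
    {A : Matrix p p ℂ} (hA : A.IsHermitian) :
    ∃ ε : ℝ, 0 < ε ∧ (1 + (ε : ℂ) • A).PosSemidef ∧ (1 + ((-ε : ℝ) : ℂ) • A).PosSemidef := by
  obtain ⟨c, hc, hle, hge⟩ : ∃ c : ℝ, 0 < c ∧ A ≤ c • 1 ∧ -A ≤ c • 1 := by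
    open scoped Matrix.Norms.L2Operator in
    have h1 := IsSelfAdjoint.le_algebraMap_norm_self (a := A) hA
    have h2 := IsSelfAdjoint.le_algebraMap_norm_self (a := -A) (IsSelfAdjoint.neg hA)
    rw [norm_neg] at h2
    rw [Algebra.algebraMap_eq_smul_one] at h1 h2
    have h3 : ‖A‖ • (1 : Matrix p p ℂ) ≤ (‖A‖ + 1) • 1 := by
      rw [add_smul, one_smul]
      exact le_add_of_nonneg_right zero_le_one
    exact ⟨‖A‖ + 1, by positivity, h1.trans h3, h2.trans h3⟩
  refine ⟨c⁻¹, inv_pos.2 hc, ?_, ?_⟩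
  · have h1 := (Matrix.le_iff.1 hge).smul (inv_pos.2 hc).le
    rw [smul_sub, smul_smul, inv_mul_cancel₀ hc.ne', one_smul, smul_neg, sub_neg_eq_add] at h1
    rwa [Complex.coe_smul]
  · have h1 := (Matrix.le_iff.1 hle).smul (inv_pos.2 hc).le
    rw [smul_sub, smul_smul, inv_mul_cancel₀ hc.ne', one_smul] at h1
    rwa [Complex.coe_smul, neg_smul, ← sub_eq_add_neg]

theorem mem_positivityDomain_one_iff (L : LinearPencil n) (t : Fin n → ℝ) :
    (⟨1, fun i => (t i : ℂ) • 1⟩ : Σ k : ℕ, Fin n → Matrix (Fin k) (Fin k) ℂ) ∈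
      L.positivityDomain ↔ (L.const + ∑ i, (t i : ℂ) • L.coeff i).PosSemidef := by
  have hev : L.eval (fun i => (t i : ℂ) • (1 : Matrix (Fin 1) (Fin 1) ℂ)) =
      (L.const + ∑ i, (t i : ℂ) • L.coeff i) ⊗ₖ (1 : Matrix (Fin 1) (Fin 1) ℂ) := by
    ext ⟨a, x⟩ ⟨b, y⟩
    simp only [eval, Matrix.add_apply, Matrix.sum_apply, Matrix.kronecker_apply,
      Matrix.smul_apply, smul_eq_mul, add_mul, Finset.sum_mul]
    exact congrArg _ (Finset.sum_congr rfl fun i _ => by ring)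
  constructor
  · rintro ⟨-, -, h⟩
    have h1 := h.submatrix fun a : Fin L.size => (a, (0 : Fin 1))
    dsimp only at h1
    rw [hev] at h1
    convert h1 using 1
    ext a b
    simp
  · intro h
    refine ⟨one_pos, fun j => ?_, ?_⟩
    · simp [Matrix.IsHermitian]
    · dsimp only
      rw [hev]
      exact h.kronecker Matrix.PosSemidef.one

/-- If not all variables have coefficient zero, the constant coefficient of a minimal hermitian
pencil that represents the free spectrahedron of a monic pencil is positive definite: as `0` is an
interior point, a kernel vector of the constant coefficient is killed by all coefficients, and
could be split off. -/
theorem IsMinimal.const_posDef {L N : LinearPencil n} (hL : L.IsHermitian) (hL1 : L.IsMonic)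
    (hN : N.IsHermitian) (hmin : N.IsMinimal) (hD : N.positivityDomain = L.positivityDomain)
    (hne : ∃ j, N.coeff j ≠ 0) (h0 : N.const.PosSemidef) : N.const.PosDef := by
  refine Matrix.PosDef.of_dotProduct_mulVec_pos hN.1 fun {v} hv =>
    lt_of_le_of_ne (h0.dotProduct_mulVec_nonneg v) fun h => ?_
  have hconst : N.const *ᵥ v = 0 := (h0.dotProduct_mulVec_zero_iff v).1 h.symm
  have hcoeff : ∀ j, N.coeff j *ᵥ v = 0 := by
    intro j
    obtain ⟨ε, hε, hpos, hneg⟩ := exists_pos_posSemidef_one_add_smul (hL.2 j)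
    have hsum : ∀ (K : LinearPencil n) (c : ℝ),
        ∑ i, ((Pi.single j c : Fin n → ℝ) i : ℂ) • K.coeff i = (c : ℂ) • K.coeff j := by
      intro K c
      rw [Finset.sum_eq_single j (fun i _ hi => by simp [hi]) (by simp)]
      simp
    have hmem : ∀ c : ℝ, (1 + (c : ℂ) • L.coeff j).PosSemidef →
        (N.const + (c : ℂ) • N.coeff j).PosSemidef := by
      intro c hc
      have h1 := (L.mem_positivityDomain_one_iff (Pi.single j c)).2 (by rw [hsum, hL1]; exact hc)
      rw [← hD, mem_positivityDomain_one_iff, hsum] at h1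
      exact h1
    have h1 := (hmem ε hpos).dotProduct_mulVec_nonneg v
    have h2 := (hmem (-ε) hneg).dotProduct_mulVec_nonneg v
    have h3 : star v ⬝ᵥ ((N.const + (ε : ℂ) • N.coeff j) *ᵥ v) = 0 := by
      refine le_antisymm ?_ h1
      have h4 : star v ⬝ᵥ ((N.const + ((-ε : ℝ) : ℂ) • N.coeff j) *ᵥ v) =
          -(star v ⬝ᵥ ((N.const + (ε : ℂ) • N.coeff j) *ᵥ v)) := by
        simp [Matrix.add_mulVec, hconst, Matrix.neg_mulVec]
      rw [h4] at h2
      exact neg_nonneg.1 h2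
    have h5 := ((hmem ε hpos).dotProduct_mulVec_zero_iff v).1 h3
    rw [Matrix.add_mulVec, hconst, zero_add, Matrix.smul_mulVec] at h5
    exact (smul_eq_zero.1 h5).resolve_left (by exact_mod_cast hε.ne')
  -- `Q` is the projection onto the line spanned by `v`.
  have hvv : star v ⬝ᵥ v ≠ 0 := fun h => hv (dotProduct_star_self_eq_zero.1 h)
  set Q : Matrix (Fin N.size) (Fin N.size) ℂ :=
    (star v ⬝ᵥ v)⁻¹ • Matrix.vecMulVec v (star v) with hQ
  have hQv : Q *ᵥ v = v := by
    rw [hQ, Matrix.smul_mulVec, Matrix.vecMulVec_mulVec]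
    ext a
    simp [hvv]
  have hCQ : ∀ C : Matrix (Fin N.size) (Fin N.size) ℂ, C *ᵥ v = 0 → C * Q = 0 := by
    intro C hC
    rw [hQ, Matrix.mul_smul, Matrix.mul_vecMulVec, hC, Matrix.zero_vecMulVec, smul_zero]
  have hQh : Qᴴ = Q := by
    have hr : star (star v ⬝ᵥ v) = star v ⬝ᵥ v := by
      rw [← Matrix.star_dotProduct_star, star_star]
    rw [hQ, Matrix.conjTranspose_smul, star_inv₀, hr, Matrix.conjTranspose_vecMulVec, star_star]
  have hfix : ∀ C : Matrix (Fin N.size) (Fin N.size) ℂ, C.IsHermitian → C *ᵥ v = 0 →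
      krausMap (fun _ : Unit => 1 - Q) C = C := by
    intro C hC hCv
    have h1 : Q * C = 0 := by
      have := congrArg Matrix.conjTranspose (hCQ C hCv)
      rwa [Matrix.conjTranspose_mul, hQh, hC.eq, Matrix.conjTranspose_zero] at this
    rw [krausMap_const, Matrix.conjTranspose_sub, hQh, Matrix.conjTranspose_one, Matrix.sub_mul,
      h1, Matrix.one_mul, sub_zero, Matrix.mul_sub, hCQ C hCv, Matrix.mul_one, sub_zero]
  have hQ0 : Q ≠ 0 := fun h => hv (by rw [← hQv, h, Matrix.zero_mulVec])
  have hQQ : Q * (1 - Q) = 0 := by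
    have : (1 - Q) * Q = 0 := hCQ _ (by rw [Matrix.sub_mulVec, hQv, Matrix.one_mulVec, sub_self])
    rw [Matrix.sub_mul, Matrix.one_mul, sub_eq_zero] at this
    rw [Matrix.mul_sub, Matrix.mul_one, ← this, sub_self]
  obtain ⟨j, hj⟩ := hne
  refine hj ?_
  have hz := hmin.eq_zero_of_mul_eq_zero hN rfl (fun _ : Unit => 1 - Q)
    (hfix _ hN.1 hconst).le (fun j => hfix _ (hN.2 j) (hcoeff j)) hQ0 (fun _ => hQQ) ()
  rw [← hfix _ (hN.2 j) (hcoeff j), hz, krausMap_const, Matrix.mul_zero]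

theorem exists_isMonic_isMinimal {L : LinearPencil n} (hL : L.IsHermitian) (hL1 : L.IsMonic) :
    ∃ M : LinearPencil n, M.IsHermitian ∧ M.IsMonic ∧ M.IsMinimal ∧
      M.positivityDomain = L.positivityDomain := by
  classical
  have hex : ∃ k : ℕ, ∃ N : LinearPencil n, N.IsHermitian ∧
      N.positivityDomain = L.positivityDomain ∧ N.size = k := ⟨_, L, hL, rfl, rfl⟩
  obtain ⟨N, hN, hD, hk⟩ := Nat.find_spec hex
  have hmin : N.IsMinimal := fun M hM hMD => by
    rw [hk]
    exact Nat.find_min' hex ⟨M, hM, hMD.trans hD, rfl⟩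
  have h0 : N.const.PosSemidef := by
    have h1 := (L.mem_positivityDomain_one_iff 0).2 (by
      simpa [show L.const = 1 from hL1] using Matrix.PosSemidef.one)
    rw [← hD, mem_positivityDomain_one_iff] at h1
    simpa using h1
  by_cases hne : ∃ j, N.coeff j ≠ 0
  · obtain ⟨Y, hY, hYi, hYi'⟩ :=
      (hmin.const_posDef hL hL1 hN hD hne h0).exists_eq_conjTranspose_mul_self
    have hDM : (N.compress N.size_pos Y⁻¹).positivityDomain = N.positivityDomain := by
      refine Set.Subset.antisymm ?_ (N.positivityDomain_subset_compress _ _)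
      have hback : ∀ C : Matrix (Fin N.size) (Fin N.size) ℂ,
          krausMap (fun _ : Unit => Y) ((Y⁻¹)ᴴ * C * Y⁻¹) = C := fun C => by
        rw [krausMap_const]
        calc Yᴴ * ((Y⁻¹)ᴴ * C * Y⁻¹) * Y = (Y⁻¹ * Y)ᴴ * C * (Y⁻¹ * Y) := by
              simp only [Matrix.conjTranspose_mul, Matrix.mul_assoc]
          _ = C := by rw [hYi', Matrix.conjTranspose_one, Matrix.one_mul, Matrix.mul_one]
      exact positivityDomain_subset_of_krausMap (L := N.compress N.size_pos Y⁻¹)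
        (fun _ : Unit => Y) (hback _).le fun _ => hback _
    refine ⟨N.compress N.size_pos Y⁻¹, compress_isHermitian hN _ _, ?_,
      fun M hM hMD => hmin M hM (hMD.trans hDM), hDM.trans hD⟩
    change (Y⁻¹)ᴴ * N.const * Y⁻¹ = 1
    calc (Y⁻¹)ᴴ * N.const * Y⁻¹ = (Y * Y⁻¹)ᴴ * (Y * Y⁻¹) := by
          rw [hY]; simp only [Matrix.conjTranspose_mul, Matrix.mul_assoc]
      _ = 1 := by rw [hYi, Matrix.conjTranspose_one, Matrix.one_mul]
  · push Not at hne
    exact ⟨constOne n, constOne_isHermitian, rfl, fun M _ _ => M.size_pos,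
      (positivityDomain_eq_constOne h0 hne).symm.trans hD⟩

end LinearPencil

theorem corollary3p3 (n : ℕ) :
    (∀ L M : LinearPencil n,
      L.IsHermitian → L.IsMonic → L.IsMinimal →
      M.IsHermitian → M.IsMonic → M.IsMinimal →
      (L.positivityDomain = M.positivityDomain ↔ L.UnitarilySimilar M)) ∧
    (∀ L : LinearPencil n, L.IsHermitian → L.IsMonic →
      ∃ M : LinearPencil n,
        (M.IsHermitian ∧ M.IsMonic ∧ M.IsMinimal ∧
          M.positivityDomain = L.positivityDomain) ∧
        ∀ M' : LinearPencil n,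
          M'.IsHermitian → M'.IsMonic → M'.IsMinimal →
          M'.positivityDomain = L.positivityDomain → M.UnitarilySimilar M') := by
  refine ⟨fun L M hL hL1 hLmin hM hM1 hMmin =>
    ⟨LinearPencil.unitarilySimilar_of_positivityDomain_eq hL hL1 hLmin hM hM1 hMmin,
      LinearPencil.UnitarilySimilar.positivityDomain_eq⟩, fun L hL hL1 => ?_⟩
  obtain ⟨M, hM, hM1, hMmin, hMD⟩ := LinearPencil.exists_isMonic_isMinimal hL hL1
  exact ⟨M, ⟨hM, hM1, hMmin, hMD⟩, fun M' hM' hM1' hMmin' hMD' =>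
    LinearPencil.unitarilySimilar_of_positivityDomain_eq hM hM1 hMmin hM' hM1' hMmin'
      (hMD.trans hMD'.symm)⟩
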